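/- Let $\Gamma$ be a group acting geometrically (that is, properly and cocompactly by isometries) on a CAT(0) space $X$. Let $\partial X$ be the boundary of $X$, that is, the set of asymptoty classes of geodesic rays in $X$, with the cone topology and the action of $\Gamma$ induced by the action on $X$. For $\gamma\in\Gamma$ of infinite order, $o(\gamma)=\infty$, let $\gamma^\infty\in\partial X$ denote the limit of the sequence $(\gamma^n x_0)_{n\in\mathbb{N}}$ in $X\cup\partial X$, where $x_0\in X$ is any point. (1) If there exists $\delta\in\Gamma$ such that $o(\delta)=\infty$ and the orbit $\Gamma\delta^\infty$ is dense in $\partial X$, then the set $\{\gamma^\infty \mid \gamma\in\Gamma,\ o(\gamma)=\infty\}$ is dense in $\partial X$. (2) Hence, if $\partial X$ is minimal, that is, if every $\Gamma$-orbit in $\partial X$ is dense in $\partial X$, then the set $\{\gamma^\infty \mid \gamma\in\Gamma,\ o(\gamma)=\infty\}$ is dense in $\partial X$. -/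

import Mathlib

open Filter Topology
open scoped NNReal

/-- `c`, restricted to `[0, dist x y]`, is a geodesic from `x` to `y` (parametrised by arc length);
the values of `c` outside this interval are irrelevant. -/
def IsGeodesicFromTo {X : Type*} [MetricSpace X] (c : ℝ → X) (x y : X) : Prop :=
  c 0 = x ∧ c (dist x y) = y ∧
    ∀ s ∈ Set.Icc 0 (dist x y), ∀ t ∈ Set.Icc 0 (dist x y), dist (c s) (c t) = |s - t|

/-- A CAT(0) space: a geodesic metric space in which every geodesic triangle is at least as thin as
its comparison triangle in the Euclidean plane. In a triangle with vertices `p, q, r`, two points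
on different sides lie on two sides that issue from a common vertex, which is called `p` here;
`x'` and `y'` are the comparison points of `c₁ s` and `c₂ t`. -/
structure IsCAT0Space (X : Type*) [MetricSpace X] : Prop where
  exists_geodesic : ∀ x y : X, ∃ c : ℝ → X, IsGeodesicFromTo c x y
  comparison : ∀ (p q r : X) (c₁ c₂ : ℝ → X),
    IsGeodesicFromTo c₁ p q → IsGeodesicFromTo c₂ p r →
    ∀ s ∈ Set.Icc 0 (dist p q), ∀ t ∈ Set.Icc 0 (dist p r),
    ∀ p' q' r' x' y' : EuclideanSpace ℝ (Fin 2),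
      dist p' q' = dist p q → dist p' r' = dist p r → dist q' r' = dist q r →
      dist p' x' = s → dist x' q' = dist p q - s →
      dist p' y' = t → dist y' r' = dist p r - t →
      dist (c₁ s) (c₂ t) ≤ dist x' y'

/-- An isometric action is geometric if it is proper (every point has a ball around it that meets
only finitely many of its translates) and cocompact. -/
structure IsGeometricAction (Γ X : Type*) [Group Γ] [MetricSpace X] [MulAction Γ X]
    [IsIsometricSMul Γ X] : Prop where
  proper : ∀ x : X, ∃ r : ℝ, 0 < r ∧
    {γ : Γ | (((γ • ·) '' Metric.ball x r) ∩ Metric.ball x r).Nonempty}.Finite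
  cocompact : ∃ K : Set X, IsCompact K ∧ ⋃ γ : Γ, (γ • ·) '' K = Set.univ

/-- A geodesic ray in `X`. -/
structure GeodesicRay (X : Type*) [MetricSpace X] where
  toFun : ℝ≥0 → X
  isometry : Isometry toFun

/-- Two geodesic rays are asymptotic if they stay at bounded distance from each other. -/
def GeodesicRay.Asymptotic {X : Type*} [MetricSpace X] (c c' : GeodesicRay X) : Prop :=
  ∃ K : ℝ, ∀ t : ℝ≥0, dist (c.toFun t) (c'.toFun t) ≤ K

instance GeodesicRay.setoid (X : Type*) [MetricSpace X] : Setoid (GeodesicRay X) where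
  r := GeodesicRay.Asymptotic
  iseqv :=
    { refl := fun c => ⟨0, fun t => by simp⟩
      symm := fun ⟨K, hK⟩ => ⟨K, fun t => by rw [dist_comm]; exact hK t⟩
      trans := fun ⟨K, hK⟩ ⟨L, hL⟩ =>
        ⟨K + L, fun t => (dist_triangle _ _ _).trans (add_le_add (hK t) (hL t))⟩ }

/-- The boundary `∂X`: the set of asymptoty classes of geodesic rays. -/
def CAT0Boundary (X : Type*) [MetricSpace X] : Type _ :=
  Quotient (GeodesicRay.setoid X)

/-- The point at infinity of a geodesic ray. -/
def GeodesicRay.endpoint {X : Type*} [MetricSpace X] (c : GeodesicRay X) : CAT0Boundary X :=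
  Quotient.mk (GeodesicRay.setoid X) c

/-- The translate of a geodesic ray by an isometry of the group. -/
def GeodesicRay.translate {Γ X : Type*} [Group Γ] [MetricSpace X] [MulAction Γ X]
    [IsIsometricSMul Γ X] (γ : Γ) (c : GeodesicRay X) : GeodesicRay X where
  toFun t := γ • c.toFun t
  isometry := (isometry_smul X γ).comp c.isometry

/-- The induced action on the boundary, `γ • [c] = [γ • c]`. -/
instance CAT0Boundary.instMulAction {Γ X : Type*} [Group Γ] [MetricSpace X] [MulAction Γ X]
    [IsIsometricSMul Γ X] : MulAction Γ (CAT0Boundary X) where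
  smul γ := Quotient.map (GeodesicRay.translate γ) fun _ _ ⟨K, hK⟩ =>
    ⟨K, fun t => (dist_smul γ _ _).trans_le (hK t)⟩
  one_smul ξ := by
    induction ξ using Quotient.inductionOn with
    | h c =>
      have h : GeodesicRay.translate (1 : Γ) c = c := by simp [GeodesicRay.translate]
      exact congrArg GeodesicRay.endpoint h
  mul_smul γ₁ γ₂ ξ := by
    induction ξ using Quotient.inductionOn with
    | h c =>
      have h : GeodesicRay.translate (γ₁ * γ₂) c =
          GeodesicRay.translate γ₁ (GeodesicRay.translate γ₂ c) := by
        simp [GeodesicRay.translate, mul_smul]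
      exact congrArg GeodesicRay.endpoint h

/-- The bordification `X ∪ ∂X`. -/
inductive Bordification (X : Type*) [MetricSpace X]
  | pt (x : X) : Bordification X
  | bd (ξ : CAT0Boundary X) : Bordification X

/-- The basic cone neighbourhood `U(c, r, ε)` of the endpoint of the ray `c`: the points `x` of `X`
at distance more than `r` from `c 0`, and the points `ξ` of `∂X`, for which the geodesic from `c 0`
to `x`, resp. the ray from `c 0` in the class `ξ`, is at time `r` at distance less than `ε`
from `c r`. -/
inductive GeodesicRay.ConeNhd {X : Type*} [MetricSpace X] (c : GeodesicRay X) (r : ℝ≥0) (ε : ℝ) :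
    Bordification X → Prop
  | pt (x : X) (g : ℝ → X) (hg : IsGeodesicFromTo g (c.toFun 0) x)
      (hr : (r : ℝ) < dist (c.toFun 0) x) (hε : dist (g r) (c.toFun r) < ε) :
      GeodesicRay.ConeNhd c r ε (Bordification.pt x)
  | bd (c' : GeodesicRay X) (h₀ : c'.toFun 0 = c.toFun 0)
      (hε : dist (c'.toFun r) (c.toFun r) < ε) :
      GeodesicRay.ConeNhd c r ε (Bordification.bd c'.endpoint)

/-- The cone topology on `X ∪ ∂X`, generated by the open balls of `X` and the cone neighbourhoods
`U(c, r, ε)`. Rays `c` with every initial point are allowed: the topology obtained from the rays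
that issue from one base point does not depend on the base point. -/
instance Bordification.coneTopology (X : Type*) [MetricSpace X] :
    TopologicalSpace (Bordification X) :=
  TopologicalSpace.generateFrom
    ({U | ∃ (x : X) (ε : ℝ), 0 < ε ∧ U = Bordification.pt '' Metric.ball x ε} ∪
      {U | ∃ (c : GeodesicRay X) (r : ℝ≥0) (ε : ℝ), 0 < r ∧ 0 < ε ∧
        U = {z | c.ConeNhd r ε z}})

/-- The boundary carries the subspace topology from `X ∪ ∂X`. -/
instance CAT0Boundary.coneTopology (X : Type*) [MetricSpace X] :
    TopologicalSpace (CAT0Boundary X) :=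
  TopologicalSpace.induced Bordification.bd (Bordification.coneTopology X)

/-- `ξ = γ^∞`, that is, for every `x₀` in `X` the sequence `γ ^ n • x₀` converges to `ξ`
in `X ∪ ∂X`. -/
def IsLimitAtInfinity {Γ X : Type*} [Group Γ] [MetricSpace X] [MulAction Γ X]
    (γ : Γ) (ξ : CAT0Boundary X) : Prop :=
  ∀ x₀ : X, Tendsto (fun n : ℕ => Bordification.pt (γ ^ n • x₀)) atTop
    (𝓝 (Bordification.bd ξ))

/-- The set `{γ^∞ | γ ∈ Γ, o(γ) = ∞}` (`orderOf γ = 0` means that `γ` has infinite order). -/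
def infiniteOrderLimits (Γ X : Type*) [Group Γ] [MetricSpace X] [MulAction Γ X] :
    Set (CAT0Boundary X) :=
  {ξ | ∃ γ : Γ, orderOf γ = 0 ∧ IsLimitAtInfinity γ ξ}

/-!
If `ξ = δ^∞`, then `γ • ξ = (γ δ γ⁻¹)^∞`, so the orbit of `δ^∞` consists of limits of elements of
infinite order. This is (1), and it reduces (2) to the existence of an element of infinite order
that has a limit at infinity.

Suppose that every element has finite order. Each of them fixes a point, the centre of one of its
orbits; moving these points into a compact set shows that there are only finitely many conjugacy
classes, so the orders are bounded by some `M`. Consequently every `x` is at distance at most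
`M * dist x (h • x)` from a fixed point of `h`. By cocompactness some `h` almost translates a unit
segment of a given ray along the ray, by an amount `w ≥ 1`, and so has a fixed point `z` at distance
of order `M * w` from it. But `dist z (c ·) ^ 2` is at least as convex as in the Euclidean plane, so
its increments over the two unit segments differ by at least `2 * w`, although `h` fixes `z` and
almost carries one segment to the other: this is a contradiction if the error is small enough.

An element of infinite order attains its minimal displacement, since by cocompactness finitely many
of its conjugates, on a compact set, decide the infimum. A point where the minimum is attained moves
along a geodesic ray, because the displacement of `δ ^ 2 ^ k` is at least `2 ^ k` times the minimum,
and the endpoint of this ray is the limit.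
-/

section Geodesics

variable {X : Type*} [MetricSpace X]

namespace IsGeodesicFromTo

variable {c : ℝ → X} {x y : X}

theorem dist_left (h : IsGeodesicFromTo c x y) {t : ℝ} (ht : t ∈ Set.Icc 0 (dist x y)) :
    dist x (c t) = t := by
  have := h.2.2 0 ⟨le_rfl, dist_nonneg⟩ t ht
  rwa [h.1, zero_sub, abs_neg, abs_of_nonneg ht.1] at this

theorem dist_right (h : IsGeodesicFromTo c x y) {t : ℝ} (ht : t ∈ Set.Icc 0 (dist x y)) :
    dist (c t) y = dist x y - t := by
  have := h.2.2 t ht (dist x y) ⟨dist_nonneg, le_rfl⟩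
  rwa [h.2.1, abs_sub_comm, abs_of_nonneg (sub_nonneg.2 ht.2)] at this

theorem reverse (h : IsGeodesicFromTo c x y) :
    IsGeodesicFromTo (fun t => c (dist x y - t)) y x := by
  have mem_Icc {t : ℝ} (ht : t ∈ Set.Icc 0 (dist y x)) : dist x y - t ∈ Set.Icc 0 (dist x y) := by
    rw [dist_comm] at ht
    exact ⟨sub_nonneg.2 ht.2, sub_le_self _ ht.1⟩
  refine ⟨by simpa using h.2.1, by simpa [dist_comm y x] using h.1, fun s hs t ht => ?_⟩
  rw [h.2.2 _ (mem_Icc hs) _ (mem_Icc ht), sub_sub_sub_cancel_left, abs_sub_comm]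

theorem smul {Γ : Type*} [SMul Γ X] [IsIsometricSMul Γ X] (h : IsGeodesicFromTo c x y) (γ : Γ) :
    IsGeodesicFromTo (fun t => γ • c t) (γ • x) (γ • y) := by
  obtain ⟨h₀, h₁, hdist⟩ := h
  simp only [IsGeodesicFromTo, dist_smul]
  exact ⟨congrArg _ h₀, congrArg _ h₁, hdist⟩

end IsGeodesicFromTo

theorem GeodesicRay.dist_eq (c : GeodesicRay X) (s t : ℝ≥0) :
    dist (c.toFun s) (c.toFun t) = |(s : ℝ) - t| := by
  rw [c.isometry.dist_eq, NNReal.dist_eq]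

theorem GeodesicRay.dist_add (c : GeodesicRay X) (u v : ℝ≥0) :
    dist (c.toFun u) (c.toFun (u + v)) = v := by
  rw [c.dist_eq, NNReal.coe_add, sub_add_cancel_left, abs_neg, NNReal.abs_eq]

theorem GeodesicRay.isGeodesicFromTo (c : GeodesicRay X) (u v : ℝ≥0) :
    IsGeodesicFromTo (fun t => c.toFun (u + t.toNNReal)) (c.toFun u) (c.toFun (u + v)) := by
  refine ⟨by simp, by simp [c.dist_add], fun s hs t ht => ?_⟩
  rw [c.dist_eq, NNReal.coe_add, NNReal.coe_add, Real.coe_toNNReal s hs.1,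
    Real.coe_toNNReal t ht.1, add_sub_add_left_eq_sub]

theorem GeodesicRay.isGeodesicFromTo_zero (c : GeodesicRay X) (v : ℝ≥0) :
    IsGeodesicFromTo (fun t => c.toFun t.toNNReal) (c.toFun 0) (c.toFun v) := by
  simpa only [zero_add] using c.isGeodesicFromTo 0 v

end Geodesics

section ComparisonGeometry

theorem mul_dist_mem_Icc {X : Type*} [PseudoMetricSpace X] {α : ℝ} (hα : α ∈ Set.Icc (0 : ℝ) 1)
    (x y : X) : α * dist x y ∈ Set.Icc 0 (dist x y) :=
  ⟨mul_nonneg hα.1 dist_nonneg, mul_le_of_le_one_left dist_nonneg hα.2⟩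

theorem norm_smul_sub_smul_sq {E : Type*} [NormedAddCommGroup E] [InnerProductSpace ℝ E]
    (v w : E) (α β : ℝ) :
    ‖α • v - β • w‖ ^ 2 =
      α * (α - β) * ‖v‖ ^ 2 + β * (β - α) * ‖w‖ ^ 2 + α * β * ‖v - w‖ ^ 2 := by
  rw [norm_sub_sq_real, norm_sub_sq_real, norm_smul, norm_smul, mul_pow, mul_pow,
    Real.norm_eq_abs, Real.norm_eq_abs, sq_abs, sq_abs, real_inner_smul_left,
    real_inner_smul_right]
  ring

theorem exists_comparison_triangle {X : Type*} [PseudoMetricSpace X] (p q r : X) :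
    ∃ v w : EuclideanSpace ℝ (Fin 2),
      ‖v‖ = dist p q ∧ ‖w‖ = dist p r ∧ ‖v - w‖ = dist q r := by
  have hpqr := dist_triangle p q r
  have hprq := dist_triangle_right p q r
  have hqpr := dist_triangle_left q r p
  have ha : 0 ≤ dist p q := dist_nonneg
  have hb : 0 ≤ dist p r := dist_nonneg
  have hc : 0 ≤ dist q r := dist_nonneg
  generalize dist p q = a at *
  generalize dist p r = b at *
  generalize dist q r = c at *
  obtain ⟨θ, hθ⟩ : ∃ θ : ℝ, 2 * a * b * Real.cos θ = a ^ 2 + b ^ 2 - c ^ 2 := by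
    rcases (mul_nonneg ha hb).eq_or_lt with hab | hab
    · have hzero : a ^ 2 + b ^ 2 - c ^ 2 = 0 := by
        rcases mul_eq_zero.1 hab.symm with rfl | rfl
        · rw [show b = c by linarith]; ring
        · rw [show a = c by linarith]; ring
      exact ⟨Real.pi / 2, by rw [Real.cos_pi_div_two, hzero, mul_zero]⟩
    · refine ⟨Real.arccos ((a ^ 2 + b ^ 2 - c ^ 2) / (2 * (a * b))), ?_⟩
      rw [Real.cos_arccos]
      · rw [mul_assoc 2, mul_div_cancel₀ _ (by positivity)]
      · rw [le_div_iff₀ (by positivity)]; nlinarith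
      · rw [div_le_one (by positivity)]; nlinarith
  refine ⟨!₂[a, 0], !₂[b * Real.cos θ, b * Real.sin θ], ?_, ?_, ?_⟩
  · simp [EuclideanSpace.norm_eq, Real.sqrt_sq_eq_abs, abs_of_nonneg ha]
  · rw [EuclideanSpace.norm_eq, Real.sqrt_eq_iff_eq_sq (by positivity) hb]
    simp [mul_pow, ← mul_add]
  · rw [EuclideanSpace.norm_eq, Real.sqrt_eq_iff_eq_sq (by positivity) hc]
    simp only [PiLp.sub_apply, Real.norm_eq_abs, sq_abs, Fin.sum_univ_two, Matrix.cons_val_zero,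
      Matrix.cons_val_one]
    linear_combination b ^ 2 * Real.sin_sq_add_cos_sq θ - hθ

end ComparisonGeometry

namespace IsCAT0Space

variable {X : Type*} [MetricSpace X]

theorem dist_sq_le (hX : IsCAT0Space X) {p q r : X} {c₁ c₂ : ℝ → X}
    (h₁ : IsGeodesicFromTo c₁ p q) (h₂ : IsGeodesicFromTo c₂ p r) {α β : ℝ}
    (hα : α ∈ Set.Icc (0 : ℝ) 1) (hβ : β ∈ Set.Icc (0 : ℝ) 1) :
    dist (c₁ (α * dist p q)) (c₂ (β * dist p r)) ^ 2 ≤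
      α * (α - β) * dist p q ^ 2 + β * (β - α) * dist p r ^ 2 + α * β * dist q r ^ 2 := by
  obtain ⟨v, w, hv, hw, hvw⟩ := exists_comparison_triangle p q r
  have norm_smul_of_mem {γ : ℝ} (hγ : γ ∈ Set.Icc (0 : ℝ) 1) (z : EuclideanSpace ℝ (Fin 2)) :
      ‖γ • z‖ = γ * ‖z‖ ∧ ‖γ • z - z‖ = ‖z‖ - γ * ‖z‖ := by
    refine ⟨norm_smul_of_nonneg hγ.1 z, ?_⟩
    have hsub : z - γ • z = (1 - γ) • z := by rw [sub_smul, one_smul]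
    rw [norm_sub_rev, hsub, norm_smul_of_nonneg (sub_nonneg.2 hγ.2), sub_mul, one_mul]
  have hcomparison := hX.comparison p q r c₁ c₂ h₁ h₂
    (α * dist p q) (mul_dist_mem_Icc hα p q)
    (β * dist p r) (mul_dist_mem_Icc hβ p r) 0 v w (α • v) (β • w)
  simp only [dist_eq_norm, zero_sub, norm_neg, norm_smul_of_mem hα, norm_smul_of_mem hβ, hv, hw,
    hvw, forall_const] at hcomparison
  calc dist (c₁ (α * dist p q)) (c₂ (β * dist p r)) ^ 2
      ≤ ‖α • v - β • w‖ ^ 2 := by gcongr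
    _ = _ := by rw [norm_smul_sub_smul_sq, hv, hw, hvw]

theorem dist_geodesic_le (hX : IsCAT0Space X) {p q r : X} {c₁ c₂ : ℝ → X}
    (h₁ : IsGeodesicFromTo c₁ p q) (h₂ : IsGeodesicFromTo c₂ p r) {α : ℝ}
    (hα : α ∈ Set.Icc (0 : ℝ) 1) :
    dist (c₁ (α * dist p q)) (c₂ (α * dist p r)) ≤ α * dist q r := by
  refine le_of_sq_le_sq ?_ (mul_nonneg hα.1 dist_nonneg)
  linarith [hX.dist_sq_le h₁ h₂ hα hα]

/-- The Bruhat–Tits (CN) inequality at an arbitrary point of the segment `[q, r]`: in the Euclidean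
plane this is Stewart's theorem, with equality. -/
theorem dist_sq_geodesic_le (hX : IsCAT0Space X) {q r : X} {c : ℝ → X}
    (hc : IsGeodesicFromTo c q r) {α : ℝ} (hα : α ∈ Set.Icc (0 : ℝ) 1) (p : X) :
    dist p (c (α * dist q r)) ^ 2 ≤
      (1 - α) * dist p q ^ 2 + α * dist p r ^ 2 - α * (1 - α) * dist q r ^ 2 := by
  obtain ⟨g, hg⟩ := hX.exists_geodesic q p
  have := hX.dist_sq_le hg hc (α := 1) ⟨zero_le_one, le_rfl⟩ hα
  rw [one_mul, hg.2.1, dist_comm q p] at this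
  linarith

theorem eq_of_dist_add_dist_eq (hX : IsCAT0Space X) {c : ℝ → X} {x y z : X}
    (hc : IsGeodesicFromTo c x z) (h : dist x y + dist y z = dist x z) : c (dist x y) = y := by
  obtain ⟨α, hα, hxy⟩ : ∃ α ∈ Set.Icc (0 : ℝ) 1, dist x y = α * dist x z := by
    refine ⟨dist x y / dist x z, ⟨by positivity, div_le_one_of_le₀ ?_ dist_nonneg⟩, ?_⟩
    · linarith [dist_nonneg (x := y) (y := z)]
    · rw [div_mul_cancel_of_imp]
      intro hxz
      linarith [dist_nonneg (x := x) (y := y), dist_nonneg (x := y) (y := z)]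
  have hyz : dist y z = (1 - α) * dist x z := by linarith
  have hstewart := hX.dist_sq_geodesic_le hc hα y
  rw [dist_comm y x, hyz, hxy] at hstewart
  rw [hxy, eq_comm, ← dist_le_zero]
  refine le_of_sq_le_sq (hstewart.trans_eq ?_) le_rfl
  ring

theorem dist_geodesic_le_two_mul (hX : IsCAT0Space X) {p q r : X} {c₁ c₂ : ℝ → X}
    (h₁ : IsGeodesicFromTo c₁ p q) (h₂ : IsGeodesicFromTo c₂ p r) {u : ℝ} (hu : 0 ≤ u)
    (hq : u ≤ dist p q) (hr : u ≤ dist p r) :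
    dist (c₁ u) (c₂ u) ≤ 2 * (u / dist p q * dist q r) := by
  set α := u / dist p q
  have hα : α ∈ Set.Icc (0 : ℝ) 1 := ⟨by positivity, div_le_one_of_le₀ hq dist_nonneg⟩
  have hu_eq : α * dist p q = u := div_mul_cancel_of_imp fun h => by linarith
  have hshift : dist (c₂ (α * dist p r)) (c₂ u) ≤ α * dist q r := by
    rw [h₂.2.2 _ (mul_dist_mem_Icc hα p r) u ⟨hu, hr⟩, ← hu_eq, ← mul_sub,
      abs_mul, abs_of_nonneg hα.1, dist_comm p r, dist_comm p q, dist_comm q r]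
    exact mul_le_mul_of_nonneg_left (abs_dist_sub_le r q p) hα.1
  have hcontract := hX.dist_geodesic_le h₁ h₂ hα
  rw [hu_eq] at hcontract
  linarith [dist_triangle (c₁ u) (c₂ (α * dist p r)) (c₂ u)]

end IsCAT0Space

section ProperSpaces

variable {X : Type*} [MetricSpace X]

theorem closedBall_add_subset_cthickening (hX : ∀ x y : X, ∃ c : ℝ → X, IsGeodesicFromTo c x y)
    (x : X) {R : ℝ} (hR : 0 ≤ R) (ρ : ℝ) :
    Metric.closedBall x (R + ρ) ⊆ Metric.cthickening ρ (Metric.closedBall x R) := by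
  intro y hy
  rw [Metric.mem_closedBall'] at hy
  rcases le_total (dist x y) R with hyR | hRy
  · exact Metric.closure_subset_cthickening ρ _ (subset_closure (Metric.mem_closedBall'.2 hyR))
  · obtain ⟨c, hc⟩ := hX x y
    refine Metric.mem_cthickening_of_dist_le y (c R) ρ _ ?_ ?_
    · rw [Metric.mem_closedBall', hc.dist_left ⟨hR, hRy⟩]
    · rw [dist_comm, hc.dist_right ⟨hR, hRy⟩]
      linarith

theorem isCompact_cthickening_of_isCompact_closedBall {X : Type*} [PseudoMetricSpace X] {ρ : ℝ}
    (hρ : 0 < ρ) (hball : ∀ x : X, IsCompact (Metric.closedBall x ρ)) {C : Set X}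
    (hC : IsCompact C) :
    IsCompact (Metric.cthickening (ρ / 2) C) := by
  obtain ⟨s, -, hs, hCs⟩ := hC.finite_cover_balls (half_pos hρ)
  refine (hs.isCompact_biUnion fun x _ => hball x).of_isClosed_subset Metric.isClosed_cthickening ?_
  rw [hC.cthickening_eq_biUnion_closedBall (half_pos hρ).le]
  intro y hy
  obtain ⟨z, hz, hyz⟩ := Set.mem_iUnion₂.1 hy
  obtain ⟨x, hx, hzx⟩ := Set.mem_iUnion₂.1 (hCs hz)
  refine Set.mem_biUnion hx ?_
  rw [Metric.mem_closedBall] at hyz ⊢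
  rw [Metric.mem_ball] at hzx
  linarith [dist_triangle y z x]

theorem properSpace_of_isCompact_closedBall
    (hX : ∀ x y : X, ∃ c : ℝ → X, IsGeodesicFromTo c x y) {ρ : ℝ} (hρ : 0 < ρ)
    (hball : ∀ x : X, IsCompact (Metric.closedBall x ρ)) : ProperSpace X := by
  rcases isEmpty_or_nonempty X with hX_empty | ⟨⟨x⟩⟩
  · exact ⟨isEmptyElim⟩
  have hcompact (n : ℕ) : IsCompact (Metric.closedBall x (n * (ρ / 2))) := by
    induction n with
    | zero => simp
    | succ n ih =>
      refine (isCompact_cthickening_of_isCompact_closedBall hρ hball ih).of_isClosed_subset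
        Metric.isClosed_closedBall ?_
      rw [Nat.cast_succ, add_one_mul]
      exact closedBall_add_subset_cthickening hX x (by positivity) _
  exact .of_seq_closedBall (tendsto_natCast_atTop_atTop.atTop_mul_const (half_pos hρ))
    (Eventually.of_forall hcompact)

end ProperSpaces

section GeometricActions

variable {Γ X : Type*} [Group Γ] [MetricSpace X] [MulAction Γ X] [IsIsometricSMul Γ X]

namespace IsGeometricAction

theorem exists_isCompact_forall_smul_mem (hΓ : IsGeometricAction Γ X) :
    ∃ K : Set X, IsCompact K ∧ ∀ x, ∃ γ : Γ, γ • x ∈ K := by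
  obtain ⟨K, hK, hKΓ⟩ := hΓ.cocompact
  refine ⟨K, hK, fun x => ?_⟩
  obtain ⟨γ, k, hk, rfl⟩ := Set.mem_iUnion.1 (hKΓ ▸ Set.mem_univ x)
  exact ⟨γ⁻¹, by simpa using hk⟩

theorem exists_finite_image_inter_ball (hΓ : IsGeometricAction Γ X) {C : Set X}
    (hC : IsCompact C) (x : X) :
    ∃ r > 0, {γ : Γ | ((γ • ·) '' C ∩ Metric.ball x r).Nonempty}.Finite := by
  obtain ⟨r, hr, hfin⟩ := hΓ.proper x
  have hpoint (y : X) : {γ : Γ | γ • y ∈ Metric.ball x r}.Finite := by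
    rcases Set.eq_empty_or_nonempty {γ : Γ | γ • y ∈ Metric.ball x r} with h | ⟨γ₀, hγ₀⟩
    · exact h ▸ Set.finite_empty
    · refine (hfin.image (· * γ₀)).subset fun γ hγ => ⟨γ * γ₀⁻¹, ?_, by simp⟩
      exact ⟨γ • y, ⟨γ₀ • y, hγ₀, by simp [smul_smul]⟩, hγ⟩
  obtain ⟨s, -, hs, hCs⟩ := hC.finite_cover_balls (half_pos hr)
  refine ⟨r / 2, half_pos hr, (hs.biUnion fun y _ => hpoint y).subset ?_⟩
  rintro γ ⟨_, ⟨z, hz, rfl⟩, hγz⟩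
  obtain ⟨y, hy, hzy⟩ := Set.mem_iUnion₂.1 (hCs hz)
  refine Set.mem_biUnion hy ?_
  rw [Metric.mem_ball] at hγz hzy
  have hyz : dist (γ • y) (γ • z) < r / 2 := by rwa [dist_smul, dist_comm]
  exact Metric.mem_ball.2 (by linarith [dist_triangle (γ • y) (γ • z) x])

theorem properlyDiscontinuousSMul (hΓ : IsGeometricAction Γ X) :
    ProperlyDiscontinuousSMul Γ X where
  finite_disjoint_inter_image {C D} hC hD := by
    choose r hr hfin using hΓ.exists_finite_image_inter_ball hC
    obtain ⟨s, -, hDs⟩ := hD.elim_nhds_subcover (fun x => Metric.ball x (r x))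
      fun x _ => Metric.ball_mem_nhds x (hr x)
    refine (s.finite_toSet.biUnion fun x _ => hfin x).subset ?_
    rintro γ ⟨y, hyC, hyD⟩
    obtain ⟨x, hx, hyx⟩ := Set.mem_iUnion₂.1 (hDs hyD)
    exact Set.mem_biUnion hx ⟨y, hyC, hyx⟩

theorem weaklyLocallyCompactSpace (hΓ : IsGeometricAction Γ X) : WeaklyLocallyCompactSpace X where
  exists_compact_mem_nhds x := by
    obtain ⟨K, hK, hKΓ⟩ := hΓ.exists_isCompact_forall_smul_mem
    obtain ⟨r, hr, hfin⟩ := hΓ.exists_finite_image_inter_ball hK x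
    refine ⟨⋃ γ ∈ {γ : Γ | ((γ • ·) '' K ∩ Metric.ball x r).Nonempty}, (γ • ·) '' K,
      hfin.isCompact_biUnion fun γ _ => hK.image (isometry_smul X γ).continuous,
      Filter.mem_of_superset (Metric.ball_mem_nhds x hr) fun y hy => ?_⟩
    obtain ⟨γ, hγ⟩ := hKΓ y
    have hy_mem : y ∈ (γ⁻¹ • ·) '' K := ⟨γ • y, hγ, inv_smul_smul γ y⟩
    exact Set.mem_biUnion (x := γ⁻¹) ⟨y, hy_mem, hy⟩ hy_mem

theorem exists_forall_isCompact_closedBall (hΓ : IsGeometricAction Γ X) :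
    ∃ ρ > 0, ∀ x : X, IsCompact (Metric.closedBall x ρ) := by
  have := hΓ.weaklyLocallyCompactSpace
  obtain ⟨K, hK, hKΓ⟩ := hΓ.exists_isCompact_forall_smul_mem
  obtain ⟨ρ, hρ, hKρ⟩ := hK.exists_isCompact_cthickening
  refine ⟨ρ, hρ, fun x => ?_⟩
  obtain ⟨γ, hγ⟩ := hKΓ x
  have hball : IsCompact (Metric.closedBall (γ • x) ρ) :=
    hKρ.of_isClosed_subset Metric.isClosed_closedBall (Metric.closedBall_subset_cthickening hγ ρ)
  simpa only [Metric.smul_closedBall, inv_smul_smul] using hball.smul γ⁻¹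

theorem properSpace (hX : IsCAT0Space X) (hΓ : IsGeometricAction Γ X) : ProperSpace X := by
  obtain ⟨ρ, hρ, hball⟩ := hΓ.exists_forall_isCompact_closedBall
  exact properSpace_of_isCompact_closedBall hX.exists_geodesic hρ hball

end IsGeometricAction

end GeometricActions

theorem finite_setOf_exists_dist_smul_le {Γ X : Type*} [PseudoMetricSpace X] [SMul Γ X]
    [ProperSpace X] [ProperlyDiscontinuousSMul Γ X] {C : Set X} (hC : IsCompact C) (R : ℝ) :
    {γ : Γ | ∃ x ∈ C, ∃ y ∈ C, dist (γ • x) y ≤ R}.Finite := by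
  refine (ProperlyDiscontinuousSMul.finite_disjoint_inter_image hC
    (hC.cthickening (r := R))).subset ?_
  rintro γ ⟨x, hx, y, hy, hxy⟩
  exact ⟨γ • x, ⟨x, hx, rfl⟩, Metric.mem_cthickening_of_dist_le _ _ _ _ hy hxy⟩

section BruhatTits

variable {X : Type*} [MetricSpace X]

theorem exists_forall_sum_dist_sq_le {X : Type*} [PseudoMetricSpace X] [ProperSpace X] [Nonempty X]
    {ι : Type*} [Fintype ι] [Nonempty ι] (p : ι → X) :
    ∃ z, ∀ y, ∑ i, dist z (p i) ^ 2 ≤ ∑ i, dist y (p i) ^ 2 := by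
  have i₀ := Classical.arbitrary ι
  refine (by fun_prop : Continuous fun y => ∑ i, dist y (p i) ^ 2).exists_forall_le ?_
  refine tendsto_atTop_mono (fun y => ?_)
    ((tendsto_pow_atTop two_ne_zero).comp (tendsto_dist_right_cocompact_atTop (p i₀)))
  exact Finset.single_le_sum (f := fun i => dist y (p i) ^ 2) (fun i _ => sq_nonneg _)
    (Finset.mem_univ i₀)

theorem IsCAT0Space.eq_of_forall_sum_dist_sq_le (hX : IsCAT0Space X) {ι : Type*} [Fintype ι]
    [Nonempty ι] {p : ι → X} {z w : X}
    (hz : ∀ y, ∑ i, dist z (p i) ^ 2 ≤ ∑ i, dist y (p i) ^ 2)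
    (hw : ∀ y, ∑ i, dist w (p i) ^ 2 ≤ ∑ i, dist y (p i) ^ 2) : w = z := by
  obtain ⟨c, hc⟩ := hX.exists_geodesic z w
  have hmid := Finset.sum_le_sum fun i (_ : i ∈ Finset.univ) =>
    hX.dist_sq_geodesic_le hc (α := 1 / 2) (by norm_num) (p i)
  simp only [dist_comm (p _), Finset.sum_sub_distrib, Finset.sum_add_distrib, ← Finset.mul_sum,
    Finset.sum_const, Finset.card_univ, nsmul_eq_mul] at hmid
  have hcard : (0 : ℝ) < Fintype.card ι := Nat.cast_pos.2 Fintype.card_pos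
  have hdist : Fintype.card ι * dist z w ^ 2 ≤ 0 := by
    linarith [hz (c (1 / 2 * dist z w)), hw z]
  rw [eq_comm, ← dist_eq_zero, ← sq_eq_zero_iff]
  exact le_antisymm (nonpos_of_mul_nonpos_right hdist hcard) (sq_nonneg _)

variable {Γ : Type*} [Group Γ] [MulAction Γ X] [IsIsometricSMul Γ X]

theorem IsCAT0Space.exists_forall_smul_eq_of_finite (hX : IsCAT0Space X) [ProperSpace X]
    [Finite Γ] {x : X} {R : ℝ} (hR : ∀ g : Γ, dist x (g • x) ≤ R) :
    ∃ z : X, (∀ g : Γ, g • z = z) ∧ dist z x ≤ R := by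
  have : Nonempty X := ⟨x⟩
  have := Fintype.ofFinite Γ
  obtain ⟨z, hz⟩ := exists_forall_sum_dist_sq_le fun g : Γ => g • x
  have hz_fixed (h : Γ) : h • z = z := by
    refine hX.eq_of_forall_sum_dist_sq_le hz fun y => ?_
    have hinv : ∑ g : Γ, dist (h • z) (g • x) ^ 2 = ∑ g : Γ, dist z (g • x) ^ 2 := by
      rw [← Equiv.sum_comp (Equiv.mulLeft h)]
      simp [mul_smul]
    exact hinv.trans_le (hz y)
  refine ⟨z, hz_fixed, ?_⟩
  have hcard : (0 : ℝ) < Fintype.card Γ := Nat.cast_pos.2 Fintype.card_pos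
  have hR₀ : 0 ≤ R := dist_nonneg.trans (hR 1)
  refine le_of_sq_le_sq (le_of_mul_le_mul_left ?_ hcard) hR₀
  calc Fintype.card Γ * dist z x ^ 2
      = ∑ g : Γ, dist z (g • x) ^ 2 := by
        rw [← nsmul_eq_mul, ← Finset.card_univ, ← Finset.sum_const]
        exact Finset.sum_congr rfl fun g _ => by rw [← dist_smul g z x, hz_fixed g]
    _ ≤ ∑ g : Γ, dist x (g • x) ^ 2 := hz x
    _ ≤ ∑ _g : Γ, R ^ 2 := Finset.sum_le_sum fun g _ => by gcongr; exact hR g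
    _ = Fintype.card Γ * R ^ 2 := by rw [Finset.sum_const, Finset.card_univ, nsmul_eq_mul]

theorem dist_pow_smul_le {Γ X : Type*} [Monoid Γ] [PseudoMetricSpace X] [MulAction Γ X]
    [IsIsometricSMul Γ X] (γ : Γ) (x : X) (n : ℕ) :
    dist x (γ ^ n • x) ≤ n * dist x (γ • x) := by
  induction n with
  | zero => simp
  | succ n ih =>
    have hstep : dist (γ ^ n • x) (γ ^ (n + 1) • x) = dist x (γ • x) := by
      rw [pow_succ, mul_smul, dist_smul]
    push_cast
    linarith [dist_triangle x (γ ^ n • x) (γ ^ (n + 1) • x)]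

theorem IsCAT0Space.exists_smul_eq_of_isOfFinOrder (hX : IsCAT0Space X) [ProperSpace X] {γ : Γ}
    (hγ : IsOfFinOrder γ) (x : X) :
    ∃ z : X, γ • z = z ∧ dist z x ≤ orderOf γ * dist x (γ • x) := by
  have : Finite (Subgroup.zpowers γ) := hγ.finite_zpowers
  have : IsIsometricSMul (Subgroup.zpowers γ) X := ⟨fun g => isometry_smul X (g : Γ)⟩
  have hR (g : Subgroup.zpowers γ) : dist x (g • x) ≤ orderOf γ * dist x (γ • x) := by
    obtain ⟨g, hg⟩ := g
    rw [← hγ.mem_powers_iff_mem_zpowers, Submonoid.mem_powers_iff] at hg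
    obtain ⟨n, rfl⟩ := hg
    change dist x (γ ^ n • x) ≤ _
    rw [← pow_mod_orderOf]
    refine (dist_pow_smul_le γ x _).trans ?_
    gcongr
    exact (Nat.mod_lt n hγ.orderOf_pos).le
  obtain ⟨z, hz, hzx⟩ := hX.exists_forall_smul_eq_of_finite hR
  exact ⟨z, hz ⟨γ, Subgroup.mem_zpowers γ⟩, hzx⟩

theorem IsGeometricAction.exists_forall_orderOf_le (hX : IsCAT0Space X)
    (hΓ : IsGeometricAction Γ X) [Nonempty X] : ∃ M, ∀ γ : Γ, orderOf γ ≤ M := by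
  have := hΓ.properSpace hX
  have := hΓ.properlyDiscontinuousSMul
  obtain ⟨K, hK, hKΓ⟩ := hΓ.exists_isCompact_forall_smul_mem
  obtain ⟨M, hM⟩ := ((finite_setOf_exists_dist_smul_le (Γ := Γ) hK 0).image orderOf).bddAbove
  refine ⟨M, fun γ => ?_⟩
  by_cases hγ : IsOfFinOrder γ
  · obtain ⟨z, hz, -⟩ := hX.exists_smul_eq_of_isOfFinOrder hγ (Classical.arbitrary X)
    obtain ⟨h, hh⟩ := hKΓ z
    rw [← MulEquiv.orderOf_eq (MulAut.conj h) γ]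
    refine hM ⟨_, ⟨h • z, hh, h • z, hh, ?_⟩, rfl⟩
    simp [mul_smul, hz]
  · simp [orderOf_eq_zero hγ]

end BruhatTits

section InfiniteOrder

variable {X : Type*} [MetricSpace X]

theorem IsCAT0Space.add_mul_dist_sq_ray_le (hX : IsCAT0Space X) (c : GeodesicRay X) (z : X)
    (u a b : ℝ≥0) :
    (a + b) * dist z (c.toFun (u + a)) ^ 2 ≤
      b * dist z (c.toFun u) ^ 2 + a * dist z (c.toFun (u + (a + b))) ^ 2 - a * b * (a + b) := by
  have hmul : (a / (a + b) : ℝ) * (a + b) = a := div_mul_cancel_of_imp fun h => by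
    linarith [a.coe_nonneg, b.coe_nonneg]
  have hstewart := hX.dist_sq_geodesic_le (c.isGeodesicFromTo u (a + b)) (α := a / (a + b))
    ⟨by positivity, div_le_one_of_le₀ (by linarith [b.coe_nonneg]) (by positivity)⟩ z
  rw [c.dist_add, NNReal.coe_add, hmul, Real.toNNReal_coe] at hstewart
  linear_combination mul_le_mul_of_nonneg_left hstewart (add_nonneg a.coe_nonneg b.coe_nonneg) +
    (dist z (c.toFun (u + (a + b))) ^ 2 - dist z (c.toFun u) ^ 2 -
      (a + b - a / (a + b) * (a + b) - a) * (a + b)) * hmul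

/-- Strong convexity of `dist z (c ·) ^ 2`: its increments over intervals of length `s` grow at
least as fast as those of `t ^ 2`. -/
theorem IsCAT0Space.dist_sq_ray_add_le (hX : IsCAT0Space X) (c : GeodesicRay X) (z : X)
    (u s w : ℝ≥0) :
    dist z (c.toFun (u + s)) ^ 2 + dist z (c.toFun (u + w)) ^ 2 + 2 * s * w ≤
      dist z (c.toFun u) ^ 2 + dist z (c.toFun (u + (w + s))) ^ 2 := by
  rcases eq_or_ne (w + s) 0 with h | h
  · obtain ⟨rfl, rfl⟩ := add_eq_zero.1 h
    simp
  · have hpos : (0 : ℝ) < w + s := by exact_mod_cast h.bot_lt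
    have hs := hX.add_mul_dist_sq_ray_le c z u s w
    have hw := hX.add_mul_dist_sq_ray_le c z u w s
    rw [add_comm s w, add_comm (s : ℝ) w] at hs
    refine le_of_mul_le_mul_left ?_ hpos
    linear_combination hs + hw

variable {Γ : Type*} [Group Γ] [MulAction Γ X] [IsIsometricSMul Γ X]

/-- Move the points `c n` back to `K`: the unit segments issuing from them subconverge, so two of
them are almost carried to each other. -/
theorem GeodesicRay.exists_almost_translation [ProperSpace X] {K : Set X} (hK : IsCompact K)
    (hKΓ : ∀ x, ∃ γ : Γ, γ • x ∈ K) (c : GeodesicRay X) {ε : ℝ} (hε : 0 < ε) :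
    ∃ (h : Γ) (u w : ℝ≥0), 1 ≤ w ∧ dist (h • c.toFun u) (c.toFun (u + w)) < ε ∧
      dist (h • c.toFun (u + 1)) (c.toFun (u + (w + 1))) < ε := by
  choose g hg using fun n : ℕ => hKΓ (c.toFun n)
  have hmem (n : ℕ) :
      (g n • c.toFun n, g n • c.toFun (n + 1)) ∈ K ×ˢ Metric.cthickening 1 K := by
    refine ⟨hg n, Metric.mem_cthickening_of_dist_le _ _ _ _ (hg n) ?_⟩
    rw [dist_smul, dist_comm, c.dist_add, NNReal.coe_one]
  obtain ⟨_, -, φ, hφ, hlim⟩ := (hK.prod hK.cthickening).tendsto_subseq hmem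
  obtain ⟨N, hN⟩ := Metric.cauchySeq_iff.1 hlim.cauchySeq ε hε
  have hclose := hN N le_rfl (N + 1) N.le_succ
  obtain ⟨w, hw⟩ := Nat.exists_eq_add_of_lt (hφ N.lt_succ_self)
  have dist_mul_smul (x y : X) : dist (((g (φ (N + 1)))⁻¹ * g (φ N)) • x) y =
      dist (g (φ N) • x) (g (φ (N + 1)) • y) := by
    rw [← dist_smul (g (φ (N + 1))), smul_smul, mul_inv_cancel_left]
  have hφ_cast : (φ (N + 1) : ℝ≥0) = φ N + (w + 1 : ℕ) := by rw [hw]; push_cast; ring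
  simp only [Function.comp, Prod.dist_eq, max_lt_iff, ← dist_mul_smul] at hclose
  rw [hφ_cast, add_assoc (φ N : ℝ≥0)] at hclose
  exact ⟨_, φ N, (w + 1 : ℕ), by simp, hclose⟩

/-- By strong convexity, `dist z (c ·) ^ 2` increases much more over `[u + w, u + w + 1]` than over
`[u, u + 1]`, whereas `h` almost carries the latter segment to the former and preserves the distance
to its fixed point `z`. -/
theorem IsCAT0Space.le_of_almost_translation (hX : IsCAT0Space X) (c : GeodesicRay X) {h : Γ}
    {z : X} (hz : h • z = z) {u w : ℝ≥0} {ε : ℝ} (hu : dist (h • c.toFun u) (c.toFun (u + w)) < ε)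
    (hu' : dist (h • c.toFun (u + 1)) (c.toFun (u + (w + 1))) < ε) :
    w ≤ ε * (2 * dist z (c.toFun u) + 1 + ε) := by
  have hconvex := hX.dist_sq_ray_add_le c z u 1 w
  have dist_smul_fixed (x : X) : dist z (h • x) = dist z x := by
    rw [← dist_smul h z x, hz]
  have hD : dist z (c.toFun u) < dist z (c.toFun (u + w)) + ε := by
    rw [← dist_smul_fixed]
    linarith [dist_triangle_right z (h • c.toFun u) (c.toFun (u + w))]
  have hD' : dist z (c.toFun (u + (w + 1))) < dist z (c.toFun (u + 1)) + ε := by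
    rw [← dist_smul_fixed (c.toFun (u + 1))]
    linarith [dist_triangle z (h • c.toFun (u + 1)) (c.toFun (u + (w + 1)))]
  have hstep : dist z (c.toFun (u + 1)) ≤ dist z (c.toFun u) + 1 := by
    simpa only [c.dist_add, NNReal.coe_one] using
      dist_triangle z (c.toFun u) (c.toFun (u + 1))
  have hε : 0 < ε := dist_nonneg.trans_lt hu
  have hlower : dist z (c.toFun u) ^ 2 - 2 * ε * dist z (c.toFun u) ≤
      dist z (c.toFun (u + w)) ^ 2 := by
    rcases le_total (dist z (c.toFun u)) (dist z (c.toFun (u + w))) with hle | hle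
    · have hsq := pow_le_pow_left₀ dist_nonneg hle 2
      have hnonneg : 0 ≤ 2 * ε * dist z (c.toFun u) := by positivity
      linarith
    · nlinarith [mul_nonneg (sub_nonneg.2 (sub_lt_iff_lt_add'.2 hD).le)
        (add_nonneg (dist_nonneg (x := z) (y := c.toFun u)) (dist_nonneg (x := z)
          (y := c.toFun (u + w)))), mul_le_mul_of_nonneg_left hle hε.le]
  have hupper : dist z (c.toFun (u + (w + 1))) ^ 2 ≤ (dist z (c.toFun (u + 1)) + ε) ^ 2 := by
    gcongr
  have hscale := mul_le_mul_of_nonneg_left hstep hε.le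
  rw [NNReal.coe_one] at hconvex
  linarith [sq_nonneg ε]

theorem IsGeometricAction.exists_orderOf_eq_zero (hX : IsCAT0Space X)
    (hΓ : IsGeometricAction Γ X) (c : GeodesicRay X) : ∃ δ : Γ, orderOf δ = 0 := by
  have : Nonempty X := ⟨c.toFun 0⟩
  have := hΓ.properSpace hX
  obtain ⟨M, hM⟩ := hΓ.exists_forall_orderOf_le hX
  obtain ⟨K, hK, hKΓ⟩ := hΓ.exists_isCompact_forall_smul_mem
  set ε : ℝ := 1 / (4 * M + 3)
  have hε : 0 < ε := by positivity
  have hεM : ε * (4 * M + 3) = 1 := one_div_mul_cancel (by positivity)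
  obtain ⟨h, u, w, hw, hu, hu'⟩ := c.exists_almost_translation hK hKΓ hε
  refine ⟨h, orderOf_eq_zero fun hfin => ?_⟩
  obtain ⟨z, hz, hzu⟩ := hX.exists_smul_eq_of_isOfFinOrder hfin (c.toFun u)
  have hdisp : dist (c.toFun u) (h • c.toFun u) ≤ w + ε := by
    have := dist_triangle_right (c.toFun u) (h • c.toFun u) (c.toFun (u + w))
    rw [c.dist_add] at this
    linarith
  have hzu' : dist z (c.toFun u) ≤ M * (w + ε) := by
    refine hzu.trans ?_
    gcongr
    exact hM h
  have hwε := hX.le_of_almost_translation c hz hu hu'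
  have hw' : (1 : ℝ) ≤ w := by exact_mod_cast hw
  have hM₀ : (0 : ℝ) ≤ M := M.cast_nonneg
  have hfar : 2 * dist z (c.toFun u) + 1 + ε ≤ (4 * M + 2) * w := by
    have hε₁ : ε ≤ 1 := div_le_one_of_le₀ (by linarith) (by positivity)
    nlinarith [mul_nonneg hM₀ (sub_nonneg.2 hw'), mul_nonneg hM₀ (sub_nonneg.2 hε₁)]
  have hcontra : (w : ℝ) < w := calc
    (w : ℝ) ≤ ε * ((4 * M + 2) * w) := hwε.trans (by gcongr)
    _ < ε * ((4 * M + 3) * w) := by gcongr; norm_num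
    _ = w := by rw [← mul_assoc, hεM, one_mul]
  exact hcontra.false

end InfiniteOrder

section Axes

/-- The set on which an element of a group acting on `X` attains its minimal displacement. For
isometries of a CAT(0) space without fixed points, it is the union of the axes. -/
def minSet {Γ X : Type*} [PseudoMetricSpace X] [SMul Γ X] (γ : Γ) : Set X :=
  {x : X | ∀ y : X, dist x (γ • x) ≤ dist y (γ • y)}

theorem IsCAT0Space.exists_ray {X ι : Type*} [MetricSpace X] (hX : IsCAT0Space X) {x : ι → X}
    {a : ι → ℝ≥0} {o : ι} (ho : a o = 0) (ha : ∀ t, ∃ i, t ≤ a i)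
    (hdist : ∀ i j, dist (x i) (x j) = dist (a i) (a j)) :
    ∃ c : GeodesicRay X, ∀ i, c.toFun (a i) = x i := by
  have hlen (i : ι) : dist (x o) (x i) = a i := by
    rw [hdist, ho, NNReal.dist_eq, NNReal.coe_zero, zero_sub, abs_neg, NNReal.abs_eq]
  choose g hg using fun i => hX.exists_geodesic (x o) (x i)
  have eq_of_le {i j : ι} (hij : a i ≤ a j) {t : ℝ≥0} (ht : t ≤ a i) : g j t = g i t := by
    have ht_mem : (t : ℝ) ∈ Set.Icc 0 (dist (x o) (x i)) := by
      rw [hlen]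
      exact ⟨t.coe_nonneg, ht⟩
    have ht_dist := (hg i).dist_left ht_mem
    have hxij : dist (x i) (x j) = a j - a i := by
      rw [hdist, dist_comm, NNReal.dist_eq, abs_of_nonneg (sub_nonneg.2 (NNReal.coe_le_coe.2 hij))]
    conv_lhs => rw [← ht_dist]
    refine hX.eq_of_dist_add_dist_eq (hg j) (le_antisymm ?_ (dist_triangle _ _ _))
    have htri := dist_triangle (g i t) (x i) (x j)
    rw [(hg i).dist_right ht_mem, hxij] at htri
    linarith [hlen i, hlen j]
  have coherent {i j : ι} {t : ℝ≥0} (hi : t ≤ a i) (hj : t ≤ a j) : g i t = g j t :=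
    (le_total (a i) (a j)).elim (fun h => (eq_of_le h hi).symm) fun h => eq_of_le h hj
  choose k hk using ha
  refine ⟨⟨fun t => g (k t) t, Isometry.of_dist_eq fun s t => ?_⟩, fun i => ?_⟩
  · have hs := (le_max_left s t).trans (hk (max s t))
    have ht := (le_max_right s t).trans (hk (max s t))
    rw [coherent (hk s) hs, coherent (hk t) ht, NNReal.dist_eq]
    refine (hg _).2.2 s ?_ t ?_ <;> rw [hlen]
    exacts [⟨s.coe_nonneg, hs⟩, ⟨t.coe_nonneg, ht⟩]
  · change g (k (a i)) (a i) = x i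
    rw [coherent (hk (a i)) le_rfl, ← hlen]
    exact (hg i).2.1

variable {Γ X : Type*} [Group Γ] [MetricSpace X] [MulAction Γ X] [IsIsometricSMul Γ X]

theorem dist_smul_conj_smul {Γ X : Type*} [Group Γ] [PseudoMetricSpace X] [MulAction Γ X]
    [IsIsometricSMul Γ X] (g δ : Γ) (x : X) :
    dist (g • x) ((g * δ * g⁻¹) • g • x) = dist x (δ • x) := by
  rw [← mul_smul, inv_mul_cancel_right, mul_smul, dist_smul]

theorem IsGeometricAction.minSet_nonempty (hX : IsCAT0Space X) (hΓ : IsGeometricAction Γ X)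
    [Nonempty X] (δ : Γ) : (minSet δ : Set X).Nonempty := by
  have := hΓ.properSpace hX
  have := hΓ.properlyDiscontinuousSMul
  obtain ⟨K, hK, hKΓ⟩ := hΓ.exists_isCompact_forall_smul_mem
  obtain ⟨x₀⟩ := ‹Nonempty X›
  set S : Set Γ :=
    {γ | IsConj δ γ} ∩ {γ | ∃ x ∈ K, ∃ y ∈ K, dist (γ • x) y ≤ dist x₀ (δ • x₀)}
  have hS : S.Finite := (finite_setOf_exists_dist_smul_le hK _).inter_of_right _
  set V : Set ℝ := ⋃ γ ∈ S, (fun x => dist x (γ • x)) '' K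
  have hV : IsCompact V := hS.isCompact_biUnion fun γ _ =>
    hK.image (continuous_id.dist (isometry_smul X γ).continuous)
  have mem_V {y : X} (hy : dist y (δ • y) ≤ dist x₀ (δ • x₀)) : dist y (δ • y) ∈ V := by
    obtain ⟨g, hg⟩ := hKΓ y
    have hdisp := dist_smul_conj_smul g δ y
    refine Set.mem_biUnion (x := g * δ * g⁻¹) ⟨isConj_iff.2 ⟨g, rfl⟩, ?_⟩ ⟨g • y, hg, hdisp⟩
    exact ⟨g • y, hg, g • y, hg, by rwa [dist_comm, hdisp]⟩
  obtain ⟨τ, hτV, hτ⟩ := hV.exists_isLeast ⟨_, mem_V le_rfl⟩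
  obtain ⟨γ, ⟨hδγ, -⟩, k, -, rfl⟩ := Set.mem_iUnion₂.1 hτV
  obtain ⟨g, rfl⟩ := isConj_iff.1 hδγ
  refine ⟨g⁻¹ • k, fun y => ?_⟩
  rw [← dist_smul_conj_smul g, smul_inv_smul]
  rcases le_total (dist y (δ • y)) (dist x₀ (δ • x₀)) with hy | hy
  · exact hτ (mem_V hy)
  · exact (hτ (mem_V le_rfl)).trans hy

theorem IsCAT0Space.two_mul_le_dist_sq_smul (hX : IsCAT0Space X) {δ : Γ} {τ : ℝ}
    (hτ : ∀ y : X, τ ≤ dist y (δ • y)) (y : X) : 2 * τ ≤ dist y (δ ^ 2 • y) := by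
  obtain ⟨c, hc⟩ := hX.exists_geodesic y (δ • y)
  have hmid := hX.dist_geodesic_le hc.reverse (hc.smul δ) (α := 1 / 2) (by norm_num)
  rw [dist_smul, dist_comm (δ • y) y, ← mul_smul, ← sq,
    show dist y (δ • y) - 1 / 2 * dist y (δ • y) = 1 / 2 * dist y (δ • y) by ring] at hmid
  linarith [hτ (c (1 / 2 * dist y (δ • y)))]

theorem IsCAT0Space.two_pow_mul_le_dist_pow_smul (hX : IsCAT0Space X) {δ : Γ} {τ : ℝ}
    (hτ : ∀ y : X, τ ≤ dist y (δ • y)) (k : ℕ) (y : X) :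
    2 ^ k * τ ≤ dist y (δ ^ 2 ^ k • y) := by
  induction k generalizing y with
  | zero => simpa using hτ y
  | succ k ih =>
    rw [pow_succ', pow_succ, pow_mul, mul_assoc]
    exact hX.two_mul_le_dist_sq_smul ih y

theorem IsCAT0Space.dist_pow_smul_of_mem_minSet (hX : IsCAT0Space X) {δ : Γ} {x : X}
    (hx : x ∈ minSet δ) (n : ℕ) : dist x (δ ^ n • x) = n * dist x (δ • x) := by
  refine le_antisymm (dist_pow_smul_le δ x n) ?_
  obtain ⟨l, hl⟩ := exists_add_of_le (Nat.lt_two_pow_self (n := n)).le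
  have hlower := hX.two_pow_mul_le_dist_pow_smul hx n x
  have htri := dist_triangle x (δ ^ n • x) (δ ^ 2 ^ n • x)
  rw [hl, pow_add, mul_smul, dist_smul] at htri
  have hcast : (2 : ℝ) ^ n = n + l := by exact_mod_cast hl
  rw [hcast, hl, pow_add, mul_smul] at hlower
  linarith [dist_pow_smul_le δ x l]

theorem IsCAT0Space.exists_ray_of_mem_minSet (hX : IsCAT0Space X) {δ : Γ} {x : X}
    (hx : x ∈ minSet δ) (hδ : 0 < dist x (δ • x)) :
    ∃ c : GeodesicRay X, ∀ n : ℕ, c.toFun (n * nndist x (δ • x)) = δ ^ n • x := by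
  refine hX.exists_ray (x := fun n : ℕ => δ ^ n • x) (o := 0) (by simp) (fun t => ?_)
    fun m n => ?_
  · obtain ⟨n, hn⟩ := exists_nat_ge (t / nndist x (δ • x))
    exact ⟨n, (div_le_iff₀ hδ).1 hn⟩
  · wlog hmn : m ≤ n generalizing m n
    · rw [dist_comm, this n m (le_of_not_ge hmn), dist_comm]
    obtain ⟨l, rfl⟩ := exists_add_of_le hmn
    rw [pow_add, mul_smul, dist_smul, hX.dist_pow_smul_of_mem_minSet hx, NNReal.dist_eq,
      abs_sub_comm]
    push_cast
    rw [add_mul, add_sub_cancel_left, abs_of_nonneg (by positivity)]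

theorem smul_ne_of_orderOf_eq_zero {Γ X : Type*} [Group Γ] [TopologicalSpace X] [MulAction Γ X]
    [ProperlyDiscontinuousSMul Γ X] {δ : Γ} (hδ : orderOf δ = 0) (x : X) : δ • x ≠ x := by
  intro hx
  have : Finite (MulAction.stabilizer Γ x) := ProperlyDiscontinuousSMul.finite_stabilizer' Γ x
  exact (orderOf_pos (⟨δ, hx⟩ : MulAction.stabilizer Γ x)).ne' ((Subgroup.orderOf_mk δ hx).trans hδ)

end Axes

section LimitsAtInfinity

variable {X : Type*} [MetricSpace X]

theorem GeodesicRay.coneNhd_bd_iff {c : GeodesicRay X} {r : ℝ≥0} {ε : ℝ} {ξ : CAT0Boundary X} :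
    c.ConeNhd r ε (.bd ξ) ↔
      ∃ c' : GeodesicRay X, c'.endpoint = ξ ∧ c'.toFun 0 = c.toFun 0 ∧
        dist (c'.toFun r) (c.toFun r) < ε := by
  constructor
  · rintro (_ | ⟨c', h₀, hε⟩)
    exact ⟨c', rfl, h₀, hε⟩
  · rintro ⟨c', rfl, h₀, hε⟩
    exact .bd c' h₀ hε

theorem IsCAT0Space.tendsto_geodesic_of_dist_ray_le (hX : IsCAT0Space X) (c : GeodesicRay X)
    {ι : Type*} {l : Filter ι} {z : ι → X} {a : ι → ℝ≥0} (ha : Tendsto a l atTop) {C : ℝ}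
    (hC : ∀ i, dist (c.toFun (a i)) (z i) ≤ C) {g : ι → ℝ → X}
    (hg : ∀ i, IsGeodesicFromTo (g i) (c.toFun 0) (z i)) (r : ℝ≥0) :
    (∀ᶠ i in l, r < dist (c.toFun 0) (z i)) ∧
      Tendsto (fun i => g i r) l (𝓝 (c.toFun r)) := by
  have hlen (i : ι) : dist (c.toFun 0) (c.toFun (a i)) = a i := by
    simpa only [zero_add] using c.dist_add 0 (a i)
  have ha' : Tendsto (fun i => (a i : ℝ)) l atTop := NNReal.tendsto_coe_atTop.2 ha
  have hfar : ∀ᶠ i in l, r < dist (c.toFun 0) (z i) := by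
    filter_upwards [ha'.eventually_gt_atTop (r + C)] with i hi
    have htri := dist_triangle_right (c.toFun 0) (c.toFun (a i)) (z i)
    rw [hlen] at htri
    linarith [hC i]
  refine ⟨hfar, tendsto_iff_dist_tendsto_zero.2 ?_⟩
  have hbound : Tendsto (fun i => 2 * (r / (a i : ℝ) * C)) l (𝓝 0) := by
    simpa using ((tendsto_const_nhds (x := (r : ℝ)).div_atTop ha').mul_const C).const_mul 2
  refine squeeze_zero' (.of_forall fun _ => dist_nonneg) ?_ hbound
  filter_upwards [hfar, ha'.eventually_ge_atTop (r : ℝ)] with i hi hri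
  have hthin := hX.dist_geodesic_le_two_mul (c.isGeodesicFromTo_zero (a i)) (hg i) r.coe_nonneg
    (by rwa [hlen]) hi.le
  rw [hlen, Real.toNNReal_coe, dist_comm] at hthin
  refine hthin.trans ?_
  gcongr
  exact hC i

theorem IsCAT0Space.tendsto_endpoint (hX : IsCAT0Space X) (c : GeodesicRay X) {ι : Type*}
    {l : Filter ι} {z : ι → X} {a : ι → ℝ≥0} (ha : Tendsto a l atTop) {C : ℝ}
    (hC : ∀ i, dist (c.toFun (a i)) (z i) ≤ C) :
    Tendsto (fun i => Bordification.pt (z i)) l (𝓝 (.bd c.endpoint)) := by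
  rw [TopologicalSpace.tendsto_nhds_generateFrom_iff]
  rintro U (⟨x, ε, -, rfl⟩ | ⟨c', r, ε, -, -, rfl⟩) hU
  · obtain ⟨y, -, hy⟩ := hU
    cases hy
  obtain ⟨c'', hcc, h₀, hε⟩ := GeodesicRay.coneNhd_bd_iff.1 hU
  obtain ⟨B, hB⟩ : c''.Asymptotic c := Quotient.exact hcc
  choose g hg using fun i => hX.exists_geodesic (c'.toFun 0) (z i)
  obtain ⟨hfar, hlim⟩ := hX.tendsto_geodesic_of_dist_ray_le c'' ha (C := B + C)
    (fun i => (dist_triangle _ _ _).trans (add_le_add (hB (a i)) (hC i))) (by rwa [h₀]) r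
  filter_upwards [hfar, (hlim.dist tendsto_const_nhds).eventually_lt_const hε] with i hi hgi
  exact .pt (z i) (g i) (hg i) (h₀ ▸ hi) hgi

variable {Γ : Type*} [Group Γ] [MulAction Γ X] [IsIsometricSMul Γ X]

theorem IsGeometricAction.exists_isLimitAtInfinity (hX : IsCAT0Space X)
    (hΓ : IsGeometricAction Γ X) [Nonempty X] {δ : Γ} (hδ : orderOf δ = 0) :
    ∃ ξ : CAT0Boundary X, IsLimitAtInfinity δ ξ := by
  have := hΓ.properlyDiscontinuousSMul
  obtain ⟨x, hx⟩ := hΓ.minSet_nonempty hX δ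
  have hpos : 0 < dist x (δ • x) := dist_pos.2 (smul_ne_of_orderOf_eq_zero hδ x).symm
  obtain ⟨c, hc⟩ := hX.exists_ray_of_mem_minSet hx hpos
  refine ⟨c.endpoint, fun x₀ => hX.tendsto_endpoint c (a := fun n => n * nndist x (δ • x))
    (C := dist x x₀) ?_ fun n => ?_⟩
  · exact tendsto_natCast_atTop_atTop.atTop_mul_const hpos
  · rw [hc, dist_smul]

end LimitsAtInfinity

section Equivariance

variable {Γ X : Type*} [Group Γ] [MetricSpace X] [MulAction Γ X] [IsIsometricSMul Γ X]

namespace Bordification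

/-- The action on `X ∪ ∂X` that extends those on `X` and on `∂X`. -/
instance instMulAction : MulAction Γ (Bordification X) where
  smul γ
    | .pt x => .pt (γ • x)
    | .bd ξ => .bd (γ • ξ)
  one_smul
    | .pt x => congrArg pt (one_smul Γ x)
    | .bd ξ => congrArg bd (one_smul Γ ξ)
  mul_smul γ₁ γ₂
    | .pt x => congrArg pt (mul_smul γ₁ γ₂ x)
    | .bd ξ => congrArg bd (mul_smul γ₁ γ₂ ξ)

theorem smul_pt (γ : Γ) (x : X) : γ • pt x = pt (γ • x) := rfl

theorem smul_bd (γ : Γ) (ξ : CAT0Boundary X) : γ • bd ξ = bd (γ • ξ) := rfl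

theorem preimage_smul_image_pt (γ : Γ) (s : Set X) :
    (γ • ·) ⁻¹' (pt '' s) = pt '' ((γ • ·) ⁻¹' s) := by
  ext z
  cases z with
  | pt x => simp [smul_pt]
  | bd ξ => simp [smul_bd]

end Bordification

theorem GeodesicRay.ConeNhd.smul {c : GeodesicRay X} {r : ℝ≥0} {ε : ℝ} {z : Bordification X}
    (h : c.ConeNhd r ε z) (γ : Γ) : (c.translate γ).ConeNhd r ε (γ • z) := by
  cases h with
  | pt x g hg hr hε =>
    exact .pt (γ • x) _ (hg.smul γ) (hr.trans_eq (dist_smul γ _ _).symm)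
      ((dist_smul γ _ _).trans_lt hε)
  | bd c' h₀ hε =>
    exact .bd (c'.translate γ) (congrArg (γ • · : X → X) h₀)
      ((dist_smul γ _ _).trans_lt hε)

theorem GeodesicRay.coneNhd_smul_iff {c : GeodesicRay X} {r : ℝ≥0} {ε : ℝ} {z : Bordification X}
    {γ : Γ} : c.ConeNhd r ε (γ • z) ↔ (c.translate γ⁻¹).ConeNhd r ε z := by
  refine ⟨fun h => inv_smul_smul γ z ▸ h.smul γ⁻¹, fun h => ?_⟩
  simpa [GeodesicRay.translate] using h.smul γ

instance Bordification.instContinuousConstSMul : ContinuousConstSMul Γ (Bordification X) where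
  continuous_const_smul γ := by
    refine continuous_generateFrom_iff.2 ?_
    rintro U (⟨x, ε, hε, rfl⟩ | ⟨c, r, ε, hr, hε, rfl⟩)
    · refine TopologicalSpace.isOpen_generateFrom_of_mem (.inl ⟨γ⁻¹ • x, ε, hε, ?_⟩)
      rw [preimage_smul_image_pt, Metric.preimage_smul_ball]
    · refine TopologicalSpace.isOpen_generateFrom_of_mem
        (.inr ⟨c.translate γ⁻¹, r, ε, hr, hε, ?_⟩)
      exact Set.ext fun z => GeodesicRay.coneNhd_smul_iff

theorem IsLimitAtInfinity.conj {δ : Γ} {ξ : CAT0Boundary X} (h : IsLimitAtInfinity δ ξ) (γ : Γ) :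
    IsLimitAtInfinity (γ * δ * γ⁻¹) (γ • ξ) := by
  intro x₀
  refine ((h (γ⁻¹ • x₀)).const_smul γ).congr fun n => ?_
  rw [Bordification.smul_pt, conj_pow, mul_smul, mul_smul]

theorem orbit_subset_infiniteOrderLimits {δ : Γ} (hδ : orderOf δ = 0) {ξ : CAT0Boundary X}
    (h : IsLimitAtInfinity δ ξ) : MulAction.orbit Γ ξ ⊆ infiniteOrderLimits Γ X := by
  rintro - ⟨γ, rfl⟩
  exact ⟨γ * δ * γ⁻¹, (MulEquiv.orderOf_eq (MulAut.conj γ) δ).trans hδ, h.conj γ⟩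

end Equivariance

theorem mainTheorem7 {Γ X : Type*} [Group Γ] [MetricSpace X] [MulAction Γ X]
    [IsIsometricSMul Γ X] (hX : IsCAT0Space X) (hΓ : IsGeometricAction Γ X) :
    ((∃ δ : Γ, orderOf δ = 0 ∧ ∃ ξ : CAT0Boundary X,
        IsLimitAtInfinity δ ξ ∧ Dense (MulAction.orbit Γ ξ)) →
      Dense (infiniteOrderLimits Γ X)) ∧
    (MulAction.IsMinimal Γ (CAT0Boundary X) → Dense (infiniteOrderLimits Γ X)) := by
  have dense_of_dense_orbit : (∃ δ : Γ, orderOf δ = 0 ∧ ∃ ξ : CAT0Boundary X,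
      IsLimitAtInfinity δ ξ ∧ Dense (MulAction.orbit Γ ξ)) → Dense (infiniteOrderLimits Γ X) := by
    rintro ⟨δ, hδ, ξ, hξ, hdense⟩
    exact hdense.mono (orbit_subset_infiniteOrderLimits hδ hξ)
  refine ⟨dense_of_dense_orbit, fun hmin => ?_⟩
  rcases isEmpty_or_nonempty (CAT0Boundary X) with hempty | ⟨⟨η⟩⟩
  · exact fun ξ => hempty.elim ξ
  obtain ⟨c, -⟩ := Quotient.exists_rep η
  have : Nonempty X := ⟨c.toFun 0⟩
  obtain ⟨δ, hδ⟩ := hΓ.exists_orderOf_eq_zero hX c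
  obtain ⟨ξ, hξ⟩ := hΓ.exists_isLimitAtInfinity hX hδ
  exact dense_of_dense_orbit ⟨δ, hδ, ξ, hξ, hmin.dense_orbit ξ⟩
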